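/- Let $\Omega=\{0,1\}^{\mathbb Z}$ with its product $\sigma$-algebra and, for $p\in(0,1)$, let $\mu_p$ be the Bernoulli-$p$ product measure on $\Omega$. Let $T:\Omega\to\Omega$, $(T\omega)_i=\omega_i\bigl(1-(1-\omega_{i-1})(1-\omega_{i+1})\bigr)$, be the map that removes isolated ones, let $\Omega'=T(\Omega)$, and let $\mu'_p=\mu_p\circ T^{-1}$ (the thinned Bernoulli field), a probability measure on $\Omega'$. For $\Delta\subset\mathbb Z$ let $\mathcal F'_\Delta$ be the $\sigma$-algebra on $\Omega'$ generated by the spins in $\Delta$; write $\mathcal F'_{<x}=\mathcal F'_{(-\infty,x)}$ and $\mathcal F'_{\le x}=\mathcal F'_{(-\infty,x]}$. A left-interval specification (LIS) on $\Omega'$ is a family $\rho=(\rho_\Lambda)$, indexed by the finite non-empty integer intervals $\Lambda=[l_\Lambda,m_\Lambda]$, of probability kernels $\rho_\Lambda$ from $(\Omega',\mathcal F'_{<l_\Lambda})$ to $(\Omega',\mathcal F'_{\le m_\Lambda})$ such that $\rho_\Lambda(B|\omega)=\mathbf 1_B(\omega)$ for all $B\in\mathcal F'_{<l_\Lambda}$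 and $\omega\in\Omega'$, and $\rho_\Delta\rho_\Lambda(f|\omega)=\rho_\Delta(f|\omega)$ whenever $\Lambda\subset\Delta$, $f\ge 0$ is $\mathcal F'_{\le m_\Lambda}$-measurable and $\omega\in\Omega'$. It is translation-invariant if it commutes with all shifts: $\rho_{\Lambda+k}(\theta_k^{-1}A|\omega)=\rho_\Lambda(A|\theta_k\omega)$ for all $k\in\mathbb Z$, all $\Lambda$, all $A\in\mathcal F'_{\le m_\Lambda}$ and $\omega\in\Omega'$, where $(\theta_k\omega)_i=\omega_{i+k}$. A probability measure $\mu$ on $\Omega'$ is consistent with $\rho$ if $\mu\rho_\Lambda(f)=\mu(f)$ for all $\Lambda$ and all $\mathcal F'_{\le m_\Lambda}$-measurable $f\ge 0$. The g-function of $\rho$ is $\omega\mapsto\rho_{\{0\}}(\sigma_0=\omega_0\,|\,\omega)$, where $\sigma_0$ is the spin at the origin. For $\omega\in\Omega'$ let $n(\omega)=0$ if $(\omega_{-2},\omega_{-1})=(0,1)$, and otherwise $n(\omega)=\min\{i\ge1:\ (\omega_{-i-1},\omega_{-i})=(1,1)\}$, with $\min\emptyset=\infty$. Put $$\lambda_{r}=\tfrac12\bigl(1-p-\sqrt{(1-p)(3p+1)}\bigr),\qquad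 \lambda_{PF}=\tfrac12\bigl(1-p+\sqrt{(1-p)(3p+1)}\bigr),\qquad a=\frac{\lambda_r}{\lambda_{PF}}.$$ **Theorem.** Let $p\in(0,1)$. The numbers $\lambda_r,\lambda_{PF}$ are exactly the eigenvalues of the matrix $Q=\begin{pmatrix}1-p&\sqrt{p(1-p)}\\ \sqrt{p(1-p)}&0\end{pmatrix}$. There are a translation-invariant LIS $\rho_p$ on $\Omega'$ with which $\mu'_p$ is consistent and a function $g_p:\mathbb N_0\cup\{\infty\}\to\mathbb R$ such that, for every $\omega\in\Omega'$, $$\rho_{p,\{0\}}(\sigma_0=0\,|\,\omega)=g_p(n(\omega)),$$ and the g-function of $\rho_p$ at $\omega$ equals $g_p(n(\omega))$ if $\omega_0=0$ and $1-g_p(n(\omega))$ if $\omega_0=1$; in particular it depends only on $\omega_0$ and $n(\omega)$. Moreover $g_p(0)=0$, $g_p(1)=1-p$, for every integer $n\ge2$ $$g_p(n)=\frac{(-1)^{n+1}|a|^n\frac{\lambda_{PF}}{1-\lambda_r}+\frac{\lambda_{PF}}{1-\lambda_{PF}}}{(-1)^n|a|^{n-1}\frac1{1-\lambda_r}+\frac1{1-\lambda_{PF}}},$$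 and $g_p(\infty)=\dfrac{\lambda_{PF}/(1-\lambda_{PF})}{1/(1-\lambda_{PF})}$ (the same formula with $|a|^\infty=0$). -/

import Mathlib

open MeasureTheory ProbabilityTheory Set
open scoped ENNReal unitInterval

namespace ThinnedBernoulli

/-- Spin configurations on the integers; `true` is the state 1 (occupied), `false` is 0. -/
abbrev Config : Type := ℤ → Bool

/-- The projection to the non-isolated configurations: a site stays occupied iff it is occupied
and has an occupied neighbour, i.e. `(T ω)_i = ω_i (1 - ∏_{j ∼ i} (1 - ω_j))`. -/
def T (ω : Config) : Config := fun i => ω i && (ω (i - 1) || ω (i + 1))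

/-- The space `Ω' = T(Ω)` of non-isolated configurations. It carries the trace of the product
σ-algebra (the subtype instance). -/
abbrev NonIso : Type := Set.range T

/-- The Bernoulli-`p` product measure on all configurations. -/
noncomputable def bernoulliField (p : I) : Measure Config :=
  Measure.infinitePi fun _ : ℤ => bernoulliMeasure true false p

/-- The thinned Bernoulli field: the image under `T` of the Bernoulli field, as a measure on the
space of non-isolated configurations. -/
noncomputable def tbf (p : I) : Measure NonIso :=
  (bernoulliField p).map (Set.rangeFactorization T)

theorem measurable_T : Measurable T := by
  refine measurable_pi_lambda _ fun i => ?_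
  have h : Measurable fun x : Bool × Bool × Bool => x.1 && (x.2.1 || x.2.2) :=
    measurable_of_countable _
  have h' : Measurable fun ω : Config => (ω i, ω (i - 1), ω (i + 1)) :=
    (measurable_pi_apply i).prodMk
      ((measurable_pi_apply (i - 1)).prodMk (measurable_pi_apply (i + 1)))
  exact h.comp h'

instance (p : I) : IsProbabilityMeasure (bernoulliField p) := by
  unfold bernoulliField; infer_instance

instance (p : I) : IsProbabilityMeasure (tbf p) :=
  Measure.isProbabilityMeasure_map (measurable_T.subtype_mk).aemeasurable

/-- The σ-algebra `F'_Δ` on the non-isolated configurations generated by the spins in `Δ`. -/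
abbrev sigmaAlg (Δ : Set ℤ) : MeasurableSpace NonIso :=
  (cylinderEvents (X := fun _ : ℤ => Bool) Δ).comap Subtype.val

/-- A left interval-specification on the non-isolated configurations: a family of probability
kernels indexed by the finite nonempty integer intervals `Λ = [l, m]`, the one of index `Λ` going
from `F'_{< l}` to `F'_{≤ m}`, which are proper and consistent. -/
structure LeftIntervalSpecification where
  kernel : (Λ : NonemptyInterval ℤ) →
    Kernel[sigmaAlg (Iio Λ.fst), sigmaAlg (Iic Λ.snd)] NonIso NonIso
  isProbability : ∀ (Λ : NonemptyInterval ℤ) (ω : NonIso), kernel Λ ω univ = 1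
  proper : ∀ (Λ : NonemptyInterval ℤ) (B : Set NonIso), MeasurableSet[sigmaAlg (Iio Λ.fst)] B →
    ∀ ω : NonIso, kernel Λ ω B = B.indicator 1 ω
  consistent : ∀ Λ Δ : NonemptyInterval ℤ, Λ ≤ Δ →
    ∀ f : NonIso → ℝ≥0∞, Measurable[sigmaAlg (Iic Λ.snd)] f → ∀ ω : NonIso,
      ∫⁻ ξ, (∫⁻ η, f η ∂(kernel Λ ξ)) ∂(kernel Δ ω) = ∫⁻ ξ, f ξ ∂(kernel Δ ω)

/-- A measure is consistent with a left interval-specification `ρ` if `μ ρ_Λ = μ` on the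
`F'_{≤ max Λ}`-measurable functions, for every finite interval `Λ`. -/
def IsConsistent (μ : Measure NonIso) (ρ : LeftIntervalSpecification) : Prop :=
  ∀ (Λ : NonemptyInterval ℤ) (f : NonIso → ℝ≥0∞), Measurable[sigmaAlg (Iic Λ.snd)] f →
    ∫⁻ ω, (∫⁻ η, f η ∂(ρ.kernel Λ ω)) ∂μ = ∫⁻ ω, f ω ∂μ

/-- The shift `(θ_k ω)_i = ω_{i+k}` on the non-isolated configurations. -/
def shift (k : ℤ) (ω : NonIso) : NonIso :=
  ⟨fun i => ω.1 (i + k), by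
    obtain ⟨_, τ, rfl⟩ := ω
    refine ⟨fun i => τ (i + k), funext fun i => ?_⟩
    simp only [T]
    rw [show i - 1 + k = i + k - 1 by ring, show i + 1 + k = i + k + 1 by ring]⟩

/-- The interval `Λ + k`. -/
def shiftInterval (k : ℤ) (Λ : NonemptyInterval ℤ) : NonemptyInterval ℤ :=
  ⟨(Λ.fst + k, Λ.snd + k), by have := Λ.fst_le_snd; simpa using this⟩

/-- Translation invariance: `ρ_{Λ+k}(θ_k⁻¹ A | ω) = ρ_Λ(A | θ_k ω)`. -/
def LeftIntervalSpecification.IsTranslationInvariant (ρ : LeftIntervalSpecification) : Prop :=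
  ∀ (k : ℤ) (Λ : NonemptyInterval ℤ) (A : Set NonIso), MeasurableSet[sigmaAlg (Iic Λ.snd)] A →
    ∀ ω : NonIso, ρ.kernel (shiftInterval k Λ) ω (shift k ⁻¹' A) = ρ.kernel Λ (shift k ω) A

/-- The single-site kernel probability `ρ_{0}(σ_0 = x | ω)`. -/
noncomputable def LeftIntervalSpecification.originProb (ρ : LeftIntervalSpecification)
    (x : Bool) (ω : NonIso) : ℝ :=
  (ρ.kernel (NonemptyInterval.pure 0) ω).real {η : NonIso | η.1 0 = x}

/-- The g-function `g(ω) = ρ_{0}(σ_0 = ω_0 | ω)`. -/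
noncomputable def LeftIntervalSpecification.gFunction (ρ : LeftIntervalSpecification)
    (ω : NonIso) : ℝ :=
  ρ.originProb (ω.1 0) ω

/-- The distance from the origin to the nearest pair of ones in the past: it is `0` if
`(ω_{-2}, ω_{-1}) = (0, 1)`, and otherwise the smallest `i ≥ 1` with
`(ω_{-i-1}, ω_{-i}) = (1, 1)`, which is `∞` if there is none. -/
noncomputable def pairDist (ω : NonIso) : ℕ∞ :=
  if ω.1 (-2) = false ∧ ω.1 (-1) = true then 0
  else ⨅ (i : ℕ) (_ : 1 ≤ i ∧ ω.1 (-(i : ℤ) - 1) = true ∧ ω.1 (-(i : ℤ)) = true), (i : ℕ∞)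

/-- The symmetric transfer matrix of the Bernoulli field constrained on isolation. -/
noncomputable def transferMatrix (p : ℝ) : Matrix (Fin 2) (Fin 2) ℝ :=
  !![1 - p, √(p * (1 - p)); √(p * (1 - p)), 0]

/-- The smaller eigenvalue of the transfer matrix. -/
noncomputable def lamR (p : ℝ) : ℝ := (1 - p - √((1 - p) * (3 * p + 1))) / 2

/-- The Perron-Frobenius eigenvalue of the transfer matrix. -/
noncomputable def lamPF (p : ℝ) : ℝ := (1 - p + √((1 - p) * (3 * p + 1))) / 2

/-- The eigenvalue ratio. -/
noncomputable def eigRatio (p : ℝ) : ℝ := lamR p / lamPF p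

end ThinnedBernoulli

open ThinnedBernoulli

/-! A pair of adjacent ones survives thinning and cuts the field in two. Suppose the thinned
configuration has ones at `s - 1` and `s` followed by `k` zeros. Then the Bernoulli field has ones
at `s - 1` and `s` too (`T_pair_iff`). What the thinned field does up to `s` depends only on the
Bernoulli spins up to `s` (`mem_pastSet_iff`). The zeros depend only on the later spins: for `k ≥
1`, site `s + 1` is empty and the next `k` sites contain no two adjacent ones (`mem_gapSet_iff`). By
independence, the probability of one more zero given the past is a ratio of consecutive gap
probabilities (`gapProb_succ`), hence a function of `n` alone (`tbf_inter_zero_pairDist`).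

The pair-free probabilities satisfy a linear recursion whose characteristic roots are the
eigenvalues of `Q`, which yields the closed formula (`pairFree_eq`, `zeroProb_eq`). If the past ends
in `01`, the last one needs its right neighbour, so `g 0 = 0`. A past without pairs is a null event
(`tbf_pairDist_eq_top`), so `g ⊤` does not affect consistency; the value `lamPF` is the limit of the
ratios.

The kernel of an interval resamples its sites from left to right with these one-site probabilities.
Consistency of the family is formal (`avg_avg`), and consistency of the measure reduces to one site
(`lintegral_step`). -/

namespace ThinnedBernoulli

/-! ### Eigenvalues of the transfer matrix -/

section Eigenvalues

variable {p : ℝ}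

theorem lamR_add_lamPF (p : ℝ) : lamR p + lamPF p = 1 - p := by
  unfold lamR lamPF; ring

theorem lamR_mul_lamPF (h0 : 0 ≤ p) (h1 : p ≤ 1) : lamR p * lamPF p = -(p * (1 - p)) := by
  have h : √((1 - p) * (3 * p + 1)) ^ 2 = (1 - p) * (3 * p + 1) :=
    Real.sq_sqrt (mul_nonneg (by linarith) (by linarith))
  unfold lamR lamPF
  linear_combination (-1 / 4) * h

theorem lamPF_pos (h1 : p < 1) : 0 < lamPF p := by
  unfold lamPF
  have := Real.sqrt_nonneg ((1 - p) * (3 * p + 1))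
  linarith

theorem lamR_neg (h0 : 0 < p) (h1 : p < 1) : lamR p < 0 := by
  have h := lamR_mul_lamPF h0.le h1.le
  have h' := lamPF_pos h1
  by_contra! h2
  nlinarith [mul_nonneg h2 h'.le, mul_pos h0 (sub_pos.2 h1)]

theorem one_sub_lamR_mul_one_sub_lamPF (h0 : 0 ≤ p) (h1 : p ≤ 1) :
    (1 - lamR p) * (1 - lamPF p) = p ^ 2 := by
  linear_combination lamR_mul_lamPF h0 h1 - lamR_add_lamPF p

theorem lamPF_lt_one (h0 : 0 < p) (h1 : p < 1) : lamPF p < 1 := by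
  have h := one_sub_lamR_mul_one_sub_lamPF h0.le h1.le
  have h' := lamR_neg h0 h1
  by_contra! h2
  nlinarith [mul_nonneg (sub_nonneg.2 (h'.le.trans zero_le_one)) (sub_nonneg.2 h2), pow_pos h0 2]

/-- The characteristic equation of `Q` is also that of the recursion defining `pairFree`. -/
theorem lamPF_sq (h0 : 0 ≤ p) (h1 : p ≤ 1) :
    lamPF p ^ 2 = (1 - p) * lamPF p + p * (1 - p) := by
  linear_combination lamPF p * lamR_add_lamPF p - lamR_mul_lamPF h0 h1

theorem lamR_sq (h0 : 0 ≤ p) (h1 : p ≤ 1) :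
    lamR p ^ 2 = (1 - p) * lamR p + p * (1 - p) := by
  linear_combination lamR p * lamR_add_lamPF p - lamR_mul_lamPF h0 h1

theorem spectrum_transferMatrix (h0 : 0 ≤ p) (h1 : p ≤ 1) :
    spectrum ℝ (transferMatrix p) = {lamR p, lamPF p} := by
  ext x
  have h : √(p * (1 - p)) ^ 2 = p * (1 - p) :=
    Real.sq_sqrt (mul_nonneg h0 (by linarith))
  have hdet : (algebraMap ℝ (Matrix (Fin 2) (Fin 2) ℝ) x - transferMatrix p).det
      = (x - lamR p) * (x - lamPF p) := by
    simp only [Matrix.algebraMap_eq_diagonal, transferMatrix, Matrix.det_fin_two, Matrix.sub_apply,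
      Matrix.of_apply, Matrix.cons_val', Matrix.cons_val_zero, Matrix.cons_val_one,
      Matrix.cons_val_fin_one, Matrix.diagonal_apply, Pi.algebraMap_apply, Algebra.algebraMap_self,
      RingHom.id_apply]
    simp
    linear_combination x * lamR_add_lamPF p - lamR_mul_lamPF h0 h1 - h
  rw [spectrum.mem_iff, Matrix.isUnit_iff_isUnit_det, hdet, isUnit_iff_ne_zero, not_not,
    mul_eq_zero, sub_eq_zero, sub_eq_zero, mem_insert_iff, mem_singleton_iff]

end Eigenvalues

/-- The probability that `n` independent Bernoulli-`p` variables, arranged in a row, have no two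
adjacent ones. -/
noncomputable def pairFree (p : ℝ) : ℕ → ℝ
  | 0 => 1
  | 1 => 1
  | n + 2 => (1 - p) * pairFree p (n + 1) + p * (1 - p) * pairFree p n

/-! ### Pair-free probabilities -/

section PairFree

variable {p : ℝ}

theorem pairFree_pos (h0 : 0 < p) (h1 : p < 1) : ∀ n, 0 < pairFree p n
  | 0 => one_pos
  | 1 => one_pos
  | n + 2 => by
    have := pairFree_pos h0 h1 n
    have := pairFree_pos h0 h1 (n + 1)
    have : 0 < 1 - p := sub_pos.2 h1
    rw [pairFree]; positivity

/-- Appending an empty site keeps a row pair-free. -/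
theorem one_sub_mul_pairFree_le (h0 : 0 < p) (h1 : p < 1) (n : ℕ) :
    (1 - p) * pairFree p n ≤ pairFree p (n + 1) := by
  cases n with
  | zero => simp [pairFree, h0.le]
  | succ n =>
    have := pairFree_pos h0 h1 n
    have : 0 < 1 - p := sub_pos.2 h1
    rw [pairFree]
    linarith [show 0 ≤ p * (1 - p) * pairFree p n by positivity]

theorem pairFree_succ_le (h0 : 0 < p) (h1 : p < 1) (n : ℕ) :
    pairFree p (n + 1) ≤ pairFree p n := by
  cases n with
  | zero => exact le_rfl
  | succ n =>
    have := mul_le_mul_of_nonneg_left (one_sub_mul_pairFree_le h0 h1 n) h0.le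
    rw [pairFree]
    linarith

/-- Each of `n` disjoint blocks of two sites must avoid the pattern `11`. The geometric decay makes
pairs occur almost surely in every past. -/
theorem pairFree_two_mul_le (h0 : 0 < p) (h1 : p < 1) (n : ℕ) :
    pairFree p (2 * n) ≤ (1 - p ^ 2) ^ n := by
  induction n with
  | zero => simp [pairFree]
  | succ n ih =>
    have h := mul_le_mul_of_nonneg_left (pairFree_succ_le h0 h1 (2 * n)) (sub_pos.2 h1).le
    have h2 : 0 < 1 - p ^ 2 := by nlinarith
    have h3 := mul_le_mul_of_nonneg_left ih h2.le
    rw [mul_add, mul_one, pairFree, pow_succ]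
    linarith

/-- Both sides satisfy the same two-term recursion; the coefficients fit the initial values `1, 1`.
-/
theorem pairFree_eq (h0 : 0 < p) (h1 : p < 1) : ∀ n,
    pairFree p n * (lamPF p - lamR p) =
      lamPF p ^ n * (1 - lamR p) - lamR p ^ n * (1 - lamPF p)
  | 0 => by simp [pairFree]
  | 1 => by simp [pairFree]; ring
  | n + 2 => by
    have e1 := pairFree_eq h0 h1 n
    have e2 := pairFree_eq h0 h1 (n + 1)
    rw [pairFree]
    linear_combination (1 - p) * e2 + p * (1 - p) * e1
      - lamPF p ^ n * (1 - lamR p) * lamPF_sq h0.le h1.le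
      + lamR p ^ n * (1 - lamPF p) * lamR_sq h0.le h1.le

end PairFree

/-- The conditional probability of a zero at the origin as a function of the distance to the
nearest pair of ones in the past. -/
noncomputable def zeroProb (p : ℝ) : ℕ∞ → ℝ
  | ⊤ => lamPF p
  | (0 : ℕ) => 0
  | (1 : ℕ) => 1 - p
  | (n + 2 : ℕ) => pairFree p (n + 2) / pairFree p (n + 1)

/-! ### The function `g` and its closed form -/

section ZeroProb

variable {p : ℝ}

theorem zeroProb_zero (p : ℝ) : zeroProb p 0 = 0 := rfl

theorem zeroProb_one (p : ℝ) : zeroProb p 1 = 1 - p := rfl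

theorem zeroProb_top (p : ℝ) : zeroProb p ⊤ = lamPF p := rfl

theorem zeroProb_add_two (p : ℝ) (n : ℕ) :
    zeroProb p (n + 2 : ℕ) = pairFree p (n + 2) / pairFree p (n + 1) := rfl

theorem zeroProb_nonneg (h0 : 0 < p) (h1 : p < 1) : ∀ n, 0 ≤ zeroProb p n
  | ⊤ => (lamPF_pos h1).le
  | (0 : ℕ) => le_rfl
  | (1 : ℕ) => (sub_pos.2 h1).le
  | (_ + 2 : ℕ) => (div_pos (pairFree_pos h0 h1 _) (pairFree_pos h0 h1 _)).le

theorem zeroProb_le_one (h0 : 0 < p) (h1 : p < 1) : ∀ n, zeroProb p n ≤ 1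
  | ⊤ => (lamPF_lt_one h0 h1).le
  | (0 : ℕ) => zero_le_one
  | (1 : ℕ) => by rw [Nat.cast_one, zeroProb_one]; linarith
  | (n + 2 : ℕ) => div_le_one_of_le₀ (pairFree_succ_le h0 h1 _) (pairFree_pos h0 h1 _).le

theorem zeroProb_eq (h0 : 0 < p) (h1 : p < 1) {n : ℕ} (hn : 2 ≤ n) :
    zeroProb p n =
      ((-1) ^ (n + 1) * |eigRatio p| ^ n * (lamPF p / (1 - lamR p))
          + lamPF p / (1 - lamPF p)) /
        ((-1) ^ n * |eigRatio p| ^ (n - 1) * (1 / (1 - lamR p))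
          + 1 / (1 - lamPF p)) := by
  obtain ⟨n, rfl⟩ := Nat.exists_eq_add_of_le' hn
  have hPF := lamPF_pos h1
  have hR := lamR_neg h0 h1
  have hPF1 : 0 < 1 - lamPF p := sub_pos.2 (lamPF_lt_one h0 h1)
  have hR1 : 0 < 1 - lamR p := by linarith
  have hd : 0 < lamPF p - lamR p := by linarith
  have habs : |eigRatio p| = -(lamR p) / lamPF p := by
    rw [eigRatio, abs_of_neg (div_neg_of_neg_of_pos hR hPF), neg_div]
  have hN : ∀ n, pairFree p n = (lamPF p ^ n * (1 - lamR p) - lamR p ^ n * (1 - lamPF p))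
      / (lamPF p - lamR p) := fun n => by
    rw [← pairFree_eq h0 h1, mul_div_cancel_right₀ _ hd.ne']
  -- The ratio `a` is negative, so the alternating signs only turn `|a| ^ k` back into `a ^ k`.
  -- Numerator and denominator then become the closed forms of `pairFree` over a common factor.
  have hsign : ∀ k, (-1 : ℝ) ^ (k + 1) * |eigRatio p| ^ k = -(lamR p ^ k / lamPF p ^ k) := by
    intro k
    rw [habs, div_pow, neg_pow (lamR p), pow_succ]
    have : ((-1 : ℝ) ^ k) * (-1) ^ k = 1 := by rw [← mul_pow]; norm_num
    linear_combination (-(lamR p ^ k / lamPF p ^ k)) * this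
  have hpos := pairFree_pos h0 h1 (n + 1)
  rw [hN] at hpos
  have hpos' := (div_pos_iff_of_pos_right hd).1 hpos
  have hnum : (-1) ^ (n + 2 + 1) * |eigRatio p| ^ (n + 2) * (lamPF p / (1 - lamR p))
      + lamPF p / (1 - lamPF p) =
      (lamPF p ^ (n + 2) * (1 - lamR p) - lamR p ^ (n + 2) * (1 - lamPF p)) /
        (lamPF p ^ (n + 1) * ((1 - lamR p) * (1 - lamPF p))) := by
    rw [hsign]; field_simp; ring
  have hden : (-1) ^ (n + 2) * |eigRatio p| ^ (n + 2 - 1) * (1 / (1 - lamR p))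
      + 1 / (1 - lamPF p) =
      (lamPF p ^ (n + 1) * (1 - lamR p) - lamR p ^ (n + 1) * (1 - lamPF p)) /
        (lamPF p ^ (n + 1) * ((1 - lamR p) * (1 - lamPF p))) := by
    rw [show n + 2 - 1 = n + 1 from rfl, hsign]; field_simp; ring
  rw [hnum, hden, zeroProb_add_two, hN, hN, div_div_div_cancel_right₀ hd.ne',
    div_div_div_cancel_right₀ (by positivity)]

end ZeroProb

/-! ### Non-isolated configurations and their extensions to the right -/

theorem mem_range_T_iff {ω : Config} :
    ω ∈ range T ↔ ∀ i, ω i = true → ω (i - 1) = true ∨ ω (i + 1) = true := by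
  constructor
  · rintro ⟨τ, rfl⟩ i
    simp only [T, Bool.and_eq_true, Bool.or_eq_true]
    rintro ⟨h, h' | h'⟩
    · exact .inl ⟨h', .inr (by simpa using h)⟩
    · exact .inr ⟨h', .inl (by simpa using h)⟩
  · intro h
    refine ⟨ω, funext fun i => ?_⟩
    have := h i
    simp only [T]
    cases hi : ω i <;> simp_all

/-- The configuration which agrees with `ω` to the left of `l` and is constant from `l` on: equal
to `x` if this leaves no isolated one at `l - 1`, and to `1` otherwise. -/
def extend (l : ℤ) (x : Bool) (ω : NonIso) : NonIso :=
  ⟨fun i => if i < l then ω.1 i else x || (!ω.1 (l - 2) && ω.1 (l - 1)), by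
    rw [mem_range_T_iff]
    intro i hi
    have hω := mem_range_T_iff.1 ω.2 i
    rcases lt_trichotomy i (l - 1) with h | rfl | h
    · simpa [show i < l by lia, show i - 1 < l by lia, show i + 1 < l by lia, hi] using hω
        (by simpa [show i < l by lia] using hi)
    · simp only [sub_lt_self_iff, zero_lt_one, if_true] at hi
      simp only [show l - 1 - 1 = l - 2 by ring, show l - 2 < l by lia, hi, if_true,
        sub_add_cancel, lt_irrefl, if_false]
      cases ω.1 (l - 2) <;> simp
    · right
      simpa [show ¬ i < l by lia, show ¬ i + 1 < l by lia] using hi⟩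

theorem extend_apply_of_lt {l : ℤ} (x : Bool) (ω : NonIso) {i : ℤ} (h : i < l) :
    (extend l x ω).1 i = ω.1 i := if_pos h

theorem extend_true_apply_of_le {l : ℤ} (ω : NonIso) {i : ℤ} (h : l ≤ i) :
    (extend l true ω).1 i = true := by
  simp [extend, h.not_gt]

theorem extend_false_apply_of_le {l : ℤ} (ω : NonIso) {i : ℤ} (h : l ≤ i) :
    (extend l false ω).1 i = (!ω.1 (l - 2) && ω.1 (l - 1)) := by
  simp [extend, h.not_gt]

theorem extend_congr {l : ℤ} (x : Bool) {ω ω' : NonIso} (h : ∀ i < l, ω.1 i = ω'.1 i) :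
    extend l x ω = extend l x ω' := by
  refine Subtype.ext (funext fun i => ?_)
  simp only [extend, h (l - 1) (by lia), h (l - 2) (by lia)]
  split_ifs with hi
  · exact h i hi
  · rfl

theorem shift_extend (k l : ℤ) (x : Bool) (ω : NonIso) :
    shift k (extend (l + k) x ω) = extend l x (shift k ω) := by
  refine Subtype.ext (funext fun i => ?_)
  simp [shift, extend, show l + k - 2 = l - 2 + k by ring, show l + k - 1 = l - 1 + k by ring]

theorem shift_shift (k l : ℤ) (ω : NonIso) : shift l (shift k ω) = shift (l + k) ω :=
  Subtype.ext (funext fun i => by simp [shift, add_assoc])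

/-! ### Measurability with respect to the past -/

section Measurability

theorem sigmaAlg_mono {Δ Δ' : Set ℤ} (h : Δ ⊆ Δ') : sigmaAlg Δ ≤ sigmaAlg Δ' :=
  MeasurableSpace.comap_mono (cylinderEvents_mono h)

theorem sigmaAlg_le (Δ : Set ℤ) : sigmaAlg Δ ≤ (inferInstance : MeasurableSpace NonIso) :=
  MeasurableSpace.comap_mono cylinderEvents_le_pi

theorem measurable_eval {Δ : Set ℤ} {i : ℤ} (hi : i ∈ Δ) :
    Measurable[sigmaAlg Δ] fun ω : NonIso => ω.1 i :=
  (measurable_cylinderEvent_apply (X := fun _ : ℤ => Bool) hi).comp (comap_measurable _)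

theorem measurable_extend (l : ℤ) (x : Bool) :
    Measurable[sigmaAlg (Iio l)] (extend l x) := by
  refine @Measurable.subtype_mk _ _ (sigmaAlg (Iio l)) _ _ _ ?_ _
  refine @measurable_pi_lambda _ _ _ (sigmaAlg (Iio l)) _ _ fun i => ?_
  by_cases hi : i < l
  · simpa only [if_pos hi] using measurable_eval (Δ := Iio l) hi
  · simp only [if_neg hi]
    have h : Measurable fun y : Bool × Bool => x || (!y.1 && y.2) := measurable_of_countable _
    exact h.comp ((measurable_eval (Δ := Iio l) (i := l - 2) (by simp)).prodMk
      (measurable_eval (Δ := Iio l) (i := l - 1) (by simp)))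

/-- The map `extend l true` retains exactly the past of `l`, so measurability for the past becomes
factorization through a single map. -/
theorem sigmaAlg_Iio_eq_comap (l : ℤ) :
    sigmaAlg (Iio l) = (inferInstance : MeasurableSpace NonIso).comap (extend l true) := by
  refine le_antisymm ?_ (measurable_extend l true).comap_le
  rw [sigmaAlg, cylinderEvents, MeasurableSpace.comap_iSup]
  refine iSup_le fun i => ?_
  rw [MeasurableSpace.comap_iSup]
  refine iSup_le fun hi => ?_
  rw [MeasurableSpace.comap_comp]
  rintro _ ⟨s, hs, rfl⟩
  refine ⟨(fun ω : NonIso => ω.1 i) ⁻¹' s,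
    (measurable_pi_apply i).comp measurable_subtype_coe hs, ?_⟩
  ext ω
  simp [extend_apply_of_lt true ω (show i < l from hi)]

theorem sigmaAlg_Iic (l : ℤ) : sigmaAlg (Iic l) = sigmaAlg (Iio (l + 1)) := by
  congr 1; ext i; simp

/-- A function which is measurable for the past of `l` only depends on the past of `l`. -/
theorem apply_eq_of_measurable {l : ℤ} {f : NonIso → ℝ≥0∞} (hf : Measurable[sigmaAlg (Iio l)] f)
    {ω ω' : NonIso} (h : ∀ i < l, ω.1 i = ω'.1 i) : f ω = f ω' := by
  rw [sigmaAlg_Iio_eq_comap] at hf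
  obtain ⟨s, -, hs⟩ := hf (measurableSet_singleton (f ω'))
  have h' : ω' ∈ f ⁻¹' {f ω'} := rfl
  have : ω ∈ f ⁻¹' {f ω'} := by
    rw [← hs, mem_preimage] at h' ⊢
    rwa [extend_congr true h]
  exact this

theorem measurable_of_apply_eq {α : Type*} [MeasurableSpace α] {l : ℤ} {f : NonIso → α}
    (hf : Measurable f) (h : ∀ ω, f (extend l true ω) = f ω) :
    Measurable[sigmaAlg (Iio l)] f := by
  rw [← funext h]
  exact hf.comp (measurable_extend l true)

end Measurability

section PairDist

theorem pairDist_congr {ω ω' : NonIso} (h : ∀ i < 0, ω.1 i = ω'.1 i) :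
    pairDist ω = pairDist ω' := by
  unfold pairDist
  rw [h (-2) (by lia), h (-1) (by lia)]
  congr 1
  refine iInf_congr fun i => ?_
  refine iInf_congr_Prop ?_ fun _ => rfl
  refine and_congr_right fun hi => ?_
  rw [h _ (by lia), h _ (by lia)]

theorem measurable_pairDist : Measurable pairDist := by
  have hm : ∀ i, Measurable fun ω : NonIso => ω.1 i := fun i =>
    (measurable_pi_apply i).comp measurable_subtype_coe
  have hs : ∀ i b, MeasurableSet {ω : NonIso | ω.1 i = b} := fun i b =>
    hm i (measurableSet_singleton b)
  have : BorelSpace ℕ∞ := ⟨borel_eq_top_of_countable.symm⟩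
  unfold pairDist
  refine Measurable.ite ((hs _ _).inter (hs _ _)) measurable_const ?_
  refine Measurable.iInf fun i => ?_
  have : (fun ω : NonIso => ⨅ (_ : 1 ≤ i ∧ ω.1 (-(i : ℤ) - 1) = true ∧ ω.1 (-(i : ℤ)) = true),
      (i : ℕ∞)) = fun ω => open Classical in
      if 1 ≤ i ∧ ω.1 (-(i : ℤ) - 1) = true ∧ ω.1 (-(i : ℤ)) = true then (i : ℕ∞) else ⊤ := by
    funext ω
    exact iInf_eq_if _
  rw [this]
  exact Measurable.ite ((MeasurableSet.const _).inter ((hs _ _).inter (hs _ _)))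
    measurable_const measurable_const

theorem measurable_shift (k : ℤ) : Measurable (shift k) :=
  (measurable_pi_lambda (fun ω : NonIso => fun i => ω.1 (i + k)) fun i =>
    (measurable_pi_apply (i + k)).comp measurable_subtype_coe).subtype_mk

end PairDist

/-- The probability of the state `x` at the site `l` given the past of `l`. -/
noncomputable def siteProb (p : ℝ) (l : ℤ) : Bool → NonIso → ℝ≥0∞
  | false, ω => ENNReal.ofReal (zeroProb p (pairDist (shift l ω)))
  | true, ω => ENNReal.ofReal (1 - zeroProb p (pairDist (shift l ω)))

/-! ### One-site probabilities -/

section SiteProb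

variable {p : ℝ}

theorem measurable_siteProb (p : ℝ) (l : ℤ) (x : Bool) : Measurable (siteProb p l x) := by
  have h : ∀ f : ℕ∞ → ℝ≥0∞, Measurable fun ω => f (pairDist (shift l ω)) := fun f =>
    (measurable_of_countable f).comp (measurable_pairDist.comp (measurable_shift l))
  cases x
  · exact h fun n => ENNReal.ofReal (zeroProb p n)
  · exact h fun n => ENNReal.ofReal (1 - zeroProb p n)

theorem siteProb_congr {l : ℤ} (x : Bool) {ω ω' : NonIso} (h : ∀ i < l, ω.1 i = ω'.1 i) :
    siteProb p l x ω = siteProb p l x ω' := by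
  have : pairDist (shift l ω) = pairDist (shift l ω') := pairDist_congr fun i hi => h _ (by lia)
  cases x <;> simp only [siteProb, this]

theorem siteProb_false_add_true (h0 : 0 < p) (h1 : p < 1) (l : ℤ) (ω : NonIso) :
    siteProb p l false ω + siteProb p l true ω = 1 := by
  rw [siteProb, siteProb, ← ENNReal.ofReal_add (zeroProb_nonneg h0 h1 _)
    (sub_nonneg.2 (zeroProb_le_one h0 h1 _))]
  simp

theorem siteProb_shift (k l : ℤ) (x : Bool) (ω : NonIso) :
    siteProb p l x (shift k ω) = siteProb p (l + k) x ω := by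
  cases x <;> simp only [siteProb, shift_shift]

end SiteProb

/-- The expectation of `f` after a resampling of the state at the site `l` given its past. -/
noncomputable def step (p : ℝ) (l : ℤ) (f : NonIso → ℝ≥0∞) (ω : NonIso) : ℝ≥0∞ :=
  siteProb p l false ω * f (extend l false ω) + siteProb p l true ω * f (extend l true ω)

/-- The expectation of `f` after a resampling of the states at the `n` sites from `l` on. -/
noncomputable def avg (p : ℝ) : ℤ → ℕ → (NonIso → ℝ≥0∞) → NonIso → ℝ≥0∞
  | _, 0, f => f
  | l, n + 1, f => step p l (avg p (l + 1) n f)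

/-- The law of the configuration after a resampling of the states at the `n` sites from `l` on. -/
noncomputable def walk (p : ℝ) : ℤ → ℕ → NonIso → Measure NonIso
  | _, 0, ω => Measure.dirac ω
  | l, n + 1, ω => siteProb p l false ω • walk p (l + 1) n (extend l false ω) +
      siteProb p l true ω • walk p (l + 1) n (extend l true ω)

/-! ### Iterated resampling -/

section Avg

variable {p : ℝ}

theorem lintegral_walk {f : NonIso → ℝ≥0∞} (hf : Measurable f) (l : ℤ) (n : ℕ) (ω : NonIso) :
    ∫⁻ η, f η ∂walk p l n ω = avg p l n f ω := by
  induction n generalizing l ω with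
  | zero => exact lintegral_dirac' ω hf
  | succ n ih =>
    simp only [walk, avg, step, lintegral_add_measure, lintegral_smul_measure, ih, smul_eq_mul]

theorem measurable_step {l : ℤ} {f : NonIso → ℝ≥0∞} (hf : Measurable f) :
    Measurable[sigmaAlg (Iio l)] (step p l f) := by
  refine measurable_of_apply_eq ?_ fun ω => ?_
  · have h := fun x => hf.comp ((measurable_extend l x).mono (sigmaAlg_le _) le_rfl)
    exact ((measurable_siteProb p l false).mul (h false)).add
      ((measurable_siteProb p l true).mul (h true))
  · have h : ∀ i < l, (extend l true ω).1 i = ω.1 i := fun i hi => extend_apply_of_lt _ _ hi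
    simp only [step, siteProb_congr _ h, extend_congr _ h]

theorem measurable_avg {f : NonIso → ℝ≥0∞} (hf : Measurable f) (l : ℤ) (n : ℕ) :
    Measurable (avg p l n f) := by
  induction n generalizing l with
  | zero => exact hf
  | succ n ih => exact (measurable_step (ih (l + 1))).mono (sigmaAlg_le _) le_rfl

theorem measurable_avg_succ {f : NonIso → ℝ≥0∞} (hf : Measurable f) (l : ℤ) (n : ℕ) :
    Measurable[sigmaAlg (Iio l)] (avg p l (n + 1) f) :=
  measurable_step (measurable_avg hf _ _)

theorem avg_add (f : NonIso → ℝ≥0∞) (l : ℤ) (m n : ℕ) :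
    avg p l (m + n) f = avg p l m (avg p (l + m) n f) := by
  induction m generalizing l with
  | zero => simp [avg]
  | succ m ih =>
    rw [show m + 1 + n = m + n + 1 by ring, avg, avg, ih]
    rw [show l + 1 + (m : ℤ) = l + (m + 1 : ℕ) by push_cast; ring]

theorem step_of_measurable (h0 : 0 < p) (h1 : p < 1) {l : ℤ} {f : NonIso → ℝ≥0∞}
    (hf : Measurable[sigmaAlg (Iio l)] f) : step p l f = f := by
  funext ω
  rw [step, apply_eq_of_measurable hf fun i hi => extend_apply_of_lt false ω hi,
    apply_eq_of_measurable hf fun i hi => extend_apply_of_lt true ω hi, ← add_mul,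
    siteProb_false_add_true h0 h1, one_mul]

theorem avg_of_measurable (h0 : 0 < p) (h1 : p < 1) {l : ℤ} (n : ℕ) {f : NonIso → ℝ≥0∞}
    (hf : Measurable[sigmaAlg (Iio l)] f) : avg p l n f = f := by
  induction n generalizing l with
  | zero => rfl
  | succ n ih =>
    rw [avg, ih (hf.mono (sigmaAlg_mono (Iio_subset_Iio (by lia))) le_rfl),
      step_of_measurable h0 h1 hf]

theorem avg_comp_shift (f : NonIso → ℝ≥0∞) (k l : ℤ) (n : ℕ) :
    avg p (l + k) n (f ∘ shift k) = avg p l n f ∘ shift k := by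
  induction n generalizing l with
  | zero => rfl
  | succ n ih =>
    rw [avg, show l + k + 1 = l + 1 + k by ring, ih]
    funext ω
    simp only [step, avg, Function.comp_apply, shift_extend, siteProb_shift]

/-- Resampling from `l + a` on does not affect a function of the past of `l + a`, such as the inner
average; nor do the last `b` resamplings affect `f`. Both sides reduce to resampling the first `a +
n` sites. This is the consistency of the specification. -/
theorem avg_avg (h0 : 0 < p) (h1 : p < 1) (f : NonIso → ℝ≥0∞) {l : ℤ} (a n b : ℕ)
    (hf : Measurable[sigmaAlg (Iio (l + a + n))] f) (hn : 0 < n) :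
    avg p l (a + n + b) (avg p (l + a) n f) = avg p l (a + n + b) f := by
  have hf' : Measurable f := hf.mono (sigmaAlg_le _) le_rfl
  obtain ⟨n, rfl⟩ := Nat.exists_eq_add_of_le' hn
  have h := measurable_avg_succ (p := p) hf' (l + a) n
  rw [add_assoc a, avg_add _ l a, avg_of_measurable h0 h1 _ h, avg_add f l a,
    avg_add f (l + a) (n + 1) b, avg_of_measurable h0 h1 b hf]

end Avg

/-- The number of sites of an interval. -/
def size (Λ : NonemptyInterval ℤ) : ℕ := (Λ.snd + 1 - Λ.fst).toNat

theorem size_pos (Λ : NonemptyInterval ℤ) : 0 < size Λ := by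
  have := Λ.fst_le_snd
  simp only [size]; lia

theorem fst_add_size (Λ : NonemptyInterval ℤ) : Λ.fst + size Λ = Λ.snd + 1 := by
  have := Λ.fst_le_snd
  simp only [size]; lia

/-- The law `walk` lives on whole configurations, completed arbitrarily to the right by `extend`;
trimming to the spins up to the end of the interval forgets the completion. -/
theorem trim_walk_apply (p : ℝ) (Λ : NonemptyInterval ℤ) (ω : NonIso) {A : Set NonIso}
    (hA : MeasurableSet[sigmaAlg (Iic Λ.snd)] A) :
    ((walk p Λ.fst (size Λ) ω).trim (sigmaAlg_le (Iic Λ.snd))) A =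
      avg p Λ.fst (size Λ) (A.indicator 1) ω := by
  have hA' : MeasurableSet A := sigmaAlg_le _ A hA
  rw [trim_measurableSet_eq _ hA, ← lintegral_indicator_one hA',
    lintegral_walk (measurable_one.indicator hA')]

theorem measurable_trim_walk (p : ℝ) (Λ : NonemptyInterval ℤ) :
    @Measurable _ _ (sigmaAlg (Iio Λ.fst)) (@Measure.instMeasurableSpace _ (sigmaAlg (Iic Λ.snd)))
      fun ω => (walk p Λ.fst (size Λ) ω).trim (sigmaAlg_le (Iic Λ.snd)) := by
  refine @Measure.measurable_of_measurable_coe _ _ (sigmaAlg (Iic Λ.snd)) (sigmaAlg (Iio Λ.fst)) _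
    fun s hs => ?_
  have hs' : MeasurableSet s := sigmaAlg_le _ s hs
  obtain ⟨n, hn⟩ := Nat.exists_eq_add_of_le' (size_pos Λ)
  rw [funext fun ω => trim_walk_apply p Λ ω hs, hn]
  exact measurable_avg_succ (measurable_one.indicator hs') Λ.fst n

/-- The left interval-specification of the thinned Bernoulli field. -/
noncomputable def lis (p : ℝ) (h0 : 0 < p) (h1 : p < 1) : LeftIntervalSpecification where
  kernel Λ :=
    @Kernel.mk _ _ (sigmaAlg (Iio Λ.fst)) (sigmaAlg (Iic Λ.snd))
      (fun ω => (walk p Λ.fst (size Λ) ω).trim (sigmaAlg_le _)) (measurable_trim_walk p Λ)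
  isProbability Λ ω := by
    change ((walk p Λ.fst (size Λ) ω).trim (sigmaAlg_le _)) univ = 1
    rw [trim_measurableSet_eq _ MeasurableSet.univ, ← lintegral_one, lintegral_walk measurable_const,
      avg_of_measurable h0 h1 _ measurable_const]
  proper Λ B hB ω := by
    have hB1 : Measurable[sigmaAlg (Iio Λ.fst)] (B.indicator (1 : NonIso → ℝ≥0∞)) :=
      @Measurable.indicator _ _ _ _ (sigmaAlg (Iio Λ.fst)) _ _
        (@measurable_one _ _ _ (sigmaAlg (Iio Λ.fst)) _) hB
    change ((walk p Λ.fst (size Λ) ω).trim (sigmaAlg_le _)) B = _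
    rw [trim_walk_apply p Λ ω (sigmaAlg_mono (fun i hi =>
        (lt_of_lt_of_le hi Λ.fst_le_snd).le) B hB), avg_of_measurable h0 h1 _ hB1]
  consistent Λ Δ h f hf ω := by
    have hf' : Measurable f := hf.mono (sigmaAlg_le _) le_rfl
    obtain ⟨hl, hr⟩ := NonemptyInterval.le_def.1 h
    change Δ.fst ≤ Λ.fst at hl
    change Λ.snd ≤ Δ.snd at hr
    have hΛ := fst_add_size Λ
    have hΔ := fst_add_size Δ
    have hI : ∀ (Θ : NonemptyInterval ℤ) (g : NonIso → ℝ≥0∞), Measurable[sigmaAlg (Iic Θ.snd)] g →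
        ∀ ξ, ∫⁻ η, g η ∂((walk p Θ.fst (size Θ) ξ).trim (sigmaAlg_le (Iic Θ.snd))) =
          avg p Θ.fst (size Θ) g ξ := fun Θ g hg ξ => by
      rw [lintegral_trim _ hg, lintegral_walk (hg.mono (sigmaAlg_le _) le_rfl)]
    have hf2 : Measurable[sigmaAlg (Iic Δ.snd)] f :=
      hf.mono (sigmaAlg_mono (Iic_subset_Iic.2 hr)) le_rfl
    have hf3 : Measurable[sigmaAlg (Iic Δ.snd)] (avg p Λ.fst (size Λ) f) := by
      obtain ⟨n, hn⟩ := Nat.exists_eq_add_of_le' (size_pos Λ)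
      rw [hn]
      exact (measurable_avg_succ hf' Λ.fst n).mono
        (sigmaAlg_mono fun i hi => (lt_of_lt_of_le hi (Λ.fst_le_snd.trans hr)).le) le_rfl
    change ∫⁻ ξ, ∫⁻ η, f η ∂((walk p Λ.fst (size Λ) ξ).trim (sigmaAlg_le (Iic Λ.snd)))
      ∂((walk p Δ.fst (size Δ) ω).trim (sigmaAlg_le (Iic Δ.snd))) =
      ∫⁻ ξ, f ξ ∂((walk p Δ.fst (size Δ) ω).trim (sigmaAlg_le (Iic Δ.snd)))
    simp only [hI Λ f hf]
    rw [hI Δ _ hf3, hI Δ f hf2]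
    -- `a` and `b` count the sites of `Δ` to the left and to the right of `Λ`.
    obtain ⟨a, ha⟩ := Int.eq_ofNat_of_zero_le (sub_nonneg.2 hl)
    obtain ⟨b, hb⟩ := Int.eq_ofNat_of_zero_le (sub_nonneg.2 hr)
    rw [sigmaAlg_Iic] at hf
    have key := avg_avg h0 h1 f (l := Δ.fst) a (size Λ) b
      (by rwa [show Δ.fst + a + size Λ = Λ.snd + 1 by lia]) (size_pos Λ)
    rw [show Δ.fst + a = Λ.fst by lia, show a + size Λ + b = size Δ by lia] at key
    exact congrFun key ω

/-! ### Shift invariance and the g-function of the specification -/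

section Lis

variable {p : ℝ} {h0 : 0 < p} {h1 : p < 1}

theorem lis_kernel_apply (Λ : NonemptyInterval ℤ) (ω : NonIso) {A : Set NonIso}
    (hA : MeasurableSet[sigmaAlg (Iic Λ.snd)] A) :
    (lis p h0 h1).kernel Λ ω A = avg p Λ.fst (size Λ) (A.indicator 1) ω :=
  trim_walk_apply p Λ ω hA

theorem lintegral_lis_kernel (Λ : NonemptyInterval ℤ) (ω : NonIso) {f : NonIso → ℝ≥0∞}
    (hf : Measurable[sigmaAlg (Iic Λ.snd)] f) :
    ∫⁻ η, f η ∂((lis p h0 h1).kernel Λ ω) = avg p Λ.fst (size Λ) f ω :=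
  (lintegral_trim (sigmaAlg_le (Iic Λ.snd)) hf).trans
    (lintegral_walk (hf.mono (sigmaAlg_le _) le_rfl) _ _ _)

theorem measurable_shift_sigmaAlg (k m : ℤ) :
    Measurable[sigmaAlg (Iic (m + k)), sigmaAlg (Iic m)] (shift k) := by
  rw [sigmaAlg, measurable_comap_iff]
  refine (@measurable_cylinderEvents_iff _ _ _ (sigmaAlg (Iic (m + k))) _ _ _).2 fun i hi => ?_
  exact measurable_eval (show i + k ≤ m + k by simpa using hi)

theorem lis_isTranslationInvariant : (lis p h0 h1).IsTranslationInvariant := by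
  intro k Λ A hA ω
  have hs : size (shiftInterval k Λ) = size Λ := by
    simp only [size, shiftInterval]; congr 1; ring
  rw [lis_kernel_apply _ _ hA, lis_kernel_apply, hs]
  · exact congrFun (avg_comp_shift (A.indicator 1) k Λ.fst (size Λ)) ω
  · exact measurable_shift_sigmaAlg k Λ.snd hA

theorem measurableSet_eval_eq {Δ : Set ℤ} {i : ℤ} (hi : i ∈ Δ) (x : Bool) :
    MeasurableSet[sigmaAlg Δ] {η : NonIso | η.1 i = x} :=
  measurable_eval hi (measurableSet_singleton x)

theorem pairDist_eq_zero {ω : NonIso} (h : ω.1 (-2) = false ∧ ω.1 (-1) = true) :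
    pairDist ω = 0 := if_pos h

/-- The extension fails to put `x` at `l` only when a zero is requested after `01`; there the weight
is `zeroProb p 0 = 0`. -/
theorem siteProb_mul_extend (l : ℤ) (x : Bool) (f : Bool → ℝ≥0∞) (ω : NonIso) :
    siteProb p l x ω * f ((extend l x ω).1 l) = siteProb p l x ω * f x := by
  cases x
  · rw [extend_false_apply_of_le ω le_rfl]
    by_cases h : ω.1 (l - 2) = false ∧ ω.1 (l - 1) = true
    · have : pairDist (shift l ω) = 0 := pairDist_eq_zero
        ⟨by simpa [shift, add_comm, ← sub_eq_add_neg] using h.1,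
          by simpa [shift, add_comm, ← sub_eq_add_neg] using h.2⟩
      simp [siteProb, this, zeroProb_zero]
    · rw [show (!ω.1 (l - 2) && ω.1 (l - 1)) = false by simpa using h]
  · rw [extend_true_apply_of_le ω le_rfl]

theorem originProb_lis (x : Bool) (ω : NonIso) :
    (lis p h0 h1).originProb x ω = (siteProb p 0 x ω).toReal := by
  rw [LeftIntervalSpecification.originProb, Measure.real, lis_kernel_apply]
  · congr 1
    have e : ∀ y, siteProb p 0 y ω * {η : NonIso | η.1 0 = x}.indicator 1 (extend 0 y ω) =
        siteProb p 0 y ω * if y = x then 1 else 0 := fun y => by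
      rw [← siteProb_mul_extend 0 y (fun y => if y = x then 1 else 0)]
      simp only [indicator_apply, mem_ofPred_eq, Pi.one_apply]
    change step p 0 _ ω = _
    rw [step, avg, e, e]
    cases x <;> simp
  · exact measurableSet_eval_eq (Δ := Iic 0) (mem_Iic.2 le_rfl) x

theorem shift_zero (ω : NonIso) : shift 0 ω = ω := Subtype.ext (funext fun i => by simp [shift])

theorem originProb_lis_false (ω : NonIso) :
    (lis p h0 h1).originProb false ω = zeroProb p (pairDist ω) := by
  rw [originProb_lis, siteProb, ENNReal.toReal_ofReal (zeroProb_nonneg h0 h1 _), shift_zero]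

theorem originProb_lis_true (ω : NonIso) :
    (lis p h0 h1).originProb true ω = 1 - zeroProb p (pairDist ω) := by
  rw [originProb_lis, siteProb, ENNReal.toReal_ofReal (sub_nonneg.2 (zeroProb_le_one h0 h1 _)),
    shift_zero]

end Lis

/-! ### Independence in the Bernoulli field -/

section Independence

variable {p : I}

theorem bernoulliField_inter {S S' : Set ℤ} (h : Disjoint S S') {A B : Set Config}
    (hA : MeasurableSet[cylinderEvents S] A) (hB : MeasurableSet[cylinderEvents S'] B) :
    bernoulliField p (A ∩ B) = bernoulliField p A * bernoulliField p B := by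
  have hi : iIndepFun (fun (i : ℤ) (η : Config) => η i) (bernoulliField p) :=
    iIndepFun_infinitePi (P := fun _ : ℤ => bernoulliMeasure true false p)
      (X := fun _ => id) fun _ => measurable_id
  have := indep_iSup_of_disjoint (fun i => (measurable_pi_apply i).comap_le) hi.iIndep h
  exact (Indep_iff _ _ _).1 this A B hA hB

theorem measurableSet_eval_eq_config {S : Set ℤ} {i : ℤ} (hi : i ∈ S) (x : Bool) :
    MeasurableSet[cylinderEvents S] {η : Config | η i = x} :=
  measurable_cylinderEvent_apply (X := fun _ : ℤ => Bool) hi (measurableSet_singleton x)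

theorem bernoulliField_eval_true (i : ℤ) :
    bernoulliField p {η | η i = true} = ENNReal.ofReal p := by
  have h : (bernoulliField p).map (fun η => η i) = bernoulliMeasure true false p :=
    Measure.infinitePi_map_eval (fun _ : ℤ => bernoulliMeasure true false p) i
  have := congrArg (fun m => m {true}) h
  rw [Measure.map_apply (measurable_pi_apply i) (measurableSet_singleton true),
    bernoulliMeasure_apply_of_mem_of_notMem _ (measurableSet_singleton true) rfl (by simp)] at this
  rw [show {η : Config | η i = true} = (fun η : Config => η i) ⁻¹' {true} from rfl, this,
    ENNReal.ofReal]
  congr 1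
  exact (Real.toNNReal_of_nonneg p.2.1).symm

theorem bernoulliField_eval_false (i : ℤ) :
    bernoulliField p {η | η i = false} = ENNReal.ofReal (1 - p) := by
  have h : {η : Config | η i = false} = {η : Config | η i = true}ᶜ := by
    ext η; simp
  rw [h, prob_compl_eq_one_sub (cylinderEvents_le_pi _
    (measurableSet_eval_eq_config (mem_univ i) true)), bernoulliField_eval_true,
    ENNReal.ofReal_sub _ p.2.1, ENNReal.ofReal_one]

end Independence

/-- No two adjacent ones among the `n` sites from `t` on. -/
def pairFreeSet (t : ℤ) (n : ℕ) : Set Config :=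
  {η | ∀ i, t ≤ i → i + 1 < t + n → ¬ (η i = true ∧ η (i + 1) = true)}

/-- If the site `s` is occupied, this is the event that the thinned configuration vanishes at the
`n` sites after `s`. -/
def gapSet (s : ℤ) : ℕ → Set Config
  | 0 => univ
  | n + 1 => {η | η (s + 1) = false} ∩ pairFreeSet (s + 2) (n + 1)

/-- The probability of `gapSet`. -/
noncomputable def gapProb (p : ℝ) : ℕ → ℝ
  | 0 => 1
  | n + 1 => (1 - p) * pairFree p (n + 1)

/-! ### Gaps after a pair of ones -/

section Gap

theorem measurableSet_pairFreeSet (t : ℤ) (n : ℕ) :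
    MeasurableSet[cylinderEvents (Ici t)] (pairFreeSet t n) := by
  have : pairFreeSet t n = ⋂ (i : ℤ) (_ : t ≤ i) (_ : i + 1 < t + n),
      ({η : Config | η i = true} ∩ {η : Config | η (i + 1) = true})ᶜ := by
    ext η; simp [pairFreeSet]
  rw [this]
  refine MeasurableSet.iInter fun i => MeasurableSet.iInter fun hi => MeasurableSet.iInter fun _ =>
    MeasurableSet.compl (MeasurableSet.inter ?_ ?_)
  · exact measurableSet_eval_eq_config (mem_Ici.2 hi) _
  · exact measurableSet_eval_eq_config (mem_Ici.2 (by lia)) _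

/-- Splitting on the spin at `t`, where a one forces a zero at `t + 1`, reproduces the recursion of
`pairFree`. -/
theorem pairFreeSet_add_two (t : ℤ) (n : ℕ) : pairFreeSet t (n + 2) =
    ({η | η t = false} ∩ pairFreeSet (t + 1) (n + 1)) ∪
      ({η | η t = true} ∩ ({η | η (t + 1) = false} ∩ pairFreeSet (t + 2) n)) := by
  ext η
  simp only [pairFreeSet, mem_union, mem_inter_iff, mem_ofPred_eq]
  constructor
  · intro h
    cases ht : η t
    · exact .inl ⟨rfl, fun i hi hi' => h i (by lia) (by push_cast at *; lia)⟩
    · refine .inr ⟨rfl, ?_, fun i hi hi' => h i (by lia) (by push_cast at *; lia)⟩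
      simpa [ht] using h t le_rfl (by push_cast; lia)
  · rintro (⟨h1, h2⟩ | ⟨h1, h2, h3⟩) i hi hi' ⟨h4, h5⟩
    · rcases hi.eq_or_lt with rfl | hi
      · simp [h1] at h4
      · exact h2 i hi (by push_cast at *; lia) ⟨h4, h5⟩
    · rcases hi.eq_or_lt with rfl | hi
      · simp [h2] at h5
      · rcases (Int.add_one_le_iff.2 hi).eq_or_lt with rfl | hi
        · simp [h2] at h4
        · exact h3 i (by lia) (by push_cast at *; lia) ⟨h4, h5⟩

variable {p : I} (h0 : 0 < p) (h1 : p < 1)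

include h0 h1 in
theorem bernoulliField_pairFreeSet (n : ℕ) : ∀ t,
    bernoulliField p (pairFreeSet t n) = ENNReal.ofReal (pairFree p n) := by
  induction n using Nat.twoStepInduction with
  | zero =>
    intro t
    rw [show pairFreeSet t 0 = univ from eq_univ_of_forall fun η i hi hi' => by
      simp at hi'; lia]
    simp [pairFree]
  | one =>
    intro t
    rw [show pairFreeSet t 1 = univ from eq_univ_of_forall fun η i hi hi' => by
      simp at hi'; lia]
    simp [pairFree]
  | more n ih1 ih2 =>
    intro t
    have hp0 : 0 < (p : ℝ) := h0
    have hp1 : (p : ℝ) < 1 := h1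
    have hm1 := measurableSet_pairFreeSet (t + 1) (n + 1)
    have hm2 := measurableSet_pairFreeSet (t + 2) n
    have hm3 : MeasurableSet[cylinderEvents (Ici (t + 1))]
        ({η : Config | η (t + 1) = false} ∩ pairFreeSet (t + 2) n) :=
      (measurableSet_eval_eq_config (mem_Ici.2 le_rfl) _).inter
        (cylinderEvents_mono (Ici_subset_Ici.2 (by lia)) _ hm2)
    have hd : ∀ s : ℤ, Disjoint {s} (Ici (s + 1)) := fun s => by simp
    rw [pairFreeSet_add_two, measure_union,
      bernoulliField_inter (hd t) (measurableSet_eval_eq_config (mem_singleton _) _) hm1,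
      bernoulliField_inter (hd t) (measurableSet_eval_eq_config (mem_singleton _) _) hm3,
      bernoulliField_inter (hd (t + 1)) (measurableSet_eval_eq_config (mem_singleton _) _)
        (by rwa [show t + 1 + 1 = t + 2 by ring]), ih1, ih2, bernoulliField_eval_false,
      bernoulliField_eval_false, bernoulliField_eval_true, pairFree,
      ← ENNReal.ofReal_mul (by linarith), ← ENNReal.ofReal_mul (by linarith),
      ← ENNReal.ofReal_mul (by linarith), ← ENNReal.ofReal_add, mul_assoc]
    · exact mul_nonneg (by linarith) (pairFree_pos hp0 hp1 _).le
    · exact mul_nonneg (by linarith) (mul_nonneg (by linarith) (pairFree_pos hp0 hp1 _).le)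
    · rw [Set.disjoint_left]
      rintro η ⟨h, -⟩ ⟨h', -⟩
      simp_all
    · exact cylinderEvents_le_pi _ ((measurableSet_eval_eq_config (mem_univ _) _).inter
        (cylinderEvents_mono (subset_univ _) _ hm3))

theorem measurableSet_gapSet (s : ℤ) (n : ℕ) :
    MeasurableSet[cylinderEvents (Ioi s)] (gapSet s n) := by
  cases n with
  | zero => exact MeasurableSet.univ
  | succ n =>
    exact (measurableSet_eval_eq_config (mem_Ioi.2 (by lia)) _).inter
      (cylinderEvents_mono (fun i hi => mem_Ioi.2 (by have := mem_Ici.1 hi; lia)) _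
        (measurableSet_pairFreeSet (s + 2) (n + 1)))

include h0 h1 in
theorem bernoulliField_gapSet (s : ℤ) (n : ℕ) :
    bernoulliField p (gapSet s n) = ENNReal.ofReal (gapProb p n) := by
  cases n with
  | zero => simp [gapSet, gapProb]
  | succ n =>
    rw [gapSet, gapProb, bernoulliField_inter (S := {s + 1}) (S' := Ici (s + 2)) (by simp)
      (measurableSet_eval_eq_config (mem_singleton _) _) (measurableSet_pairFreeSet _ _),
      bernoulliField_pairFreeSet h0 h1, bernoulliField_eval_false,
      ← ENNReal.ofReal_mul (sub_nonneg.2 p.2.2)]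

include h0 h1 in
-- The factor `1 - p` for the empty site after the pair cancels in the ratio except for the first
-- zero, whence the separate value `g 1`.
theorem gapProb_succ (n : ℕ) : gapProb p (n + 1) = zeroProb p (n + 1 : ℕ) * gapProb p n := by
  have hp0 : 0 < (p : ℝ) := h0
  have hp1 : (p : ℝ) < 1 := h1
  cases n with
  | zero =>
    rw [gapProb, gapProb, zero_add, Nat.cast_one, zeroProb_one, pairFree]
  | succ n =>
    have := pairFree_pos hp0 hp1 (n + 1)
    rw [gapProb, gapProb, zeroProb_add_two]
    field_simp

/-- A one at `s + 1` would survive beside `s`, so `s + 1` must be empty; later ones are removed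
exactly when no two are adjacent. The condition reaches site `s + n + 1`, one beyond the gap, since
that spin decides whether a one at `s + n` survives. -/
theorem mem_gapSet_iff {s : ℤ} (n : ℕ) {η : Config} (hs : η s = true) :
    η ∈ gapSet s n ↔ ∀ i, s < i → i ≤ s + n → T η i = false := by
  have hT : ∀ i, T η i = false ↔ ¬ (η i = true ∧ (η (i - 1) = true ∨ η (i + 1) = true)) := by
    intro i
    rw [← Bool.not_eq_true, T, Bool.and_eq_true, Bool.or_eq_true]
  cases n with
  | zero => simpa [gapSet] using fun i h h' => absurd h h'.not_gt
  | succ n =>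
    simp only [hT, gapSet, pairFreeSet, mem_inter_iff, mem_ofPred_eq]
    constructor
    · rintro ⟨h1, h2⟩ i hi hi' ⟨h3, h4 | h4⟩
      · have h5 : i ≠ s + 1 := by rintro rfl; simp [h1] at h3
        have h6 : i ≠ s + 2 := by
          rintro rfl; rw [show s + 2 - 1 = s + 1 by ring] at h4; simp [h1] at h4
        exact h2 (i - 1) (by lia) (by push_cast at *; lia) ⟨h4, by simpa using h3⟩
      · have h5 : i ≠ s + 1 := by rintro rfl; simp [h1] at h3
        exact h2 i (by lia) (by push_cast at *; lia) ⟨h3, h4⟩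
    · intro h
      refine ⟨?_, fun i hi hi' h' => ?_⟩
      · simpa [hs] using h (s + 1) (by lia) (by push_cast; lia)
      · exact h i (by lia) (by push_cast at *; lia) ⟨h'.1, .inr h'.2⟩

end Gap

/-! ### Locating the last pair of ones -/

section PairDistEq

theorem pairDist_eq_zero_iff {ω : NonIso} :
    pairDist ω = 0 ↔ ω.1 (-2) = false ∧ ω.1 (-1) = true := by
  refine ⟨fun h => ?_, pairDist_eq_zero⟩
  by_contra hc
  rw [pairDist, if_neg hc] at h
  have : (1 : ℕ∞) ≤ 0 := by
    rw [← h]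
    exact le_iInf₂ fun i hi => by exact_mod_cast hi.1
  simp at this

theorem pairDist_le {ω : NonIso} {i : ℕ} (hi : 1 ≤ i)
    (h : ω.1 (-(i : ℤ) - 1) = true ∧ ω.1 (-(i : ℤ)) = true) : pairDist ω ≤ i := by
  unfold pairDist
  split_ifs
  · exact zero_le
  · exact iInf₂_le i ⟨hi, h⟩

/-- A one between the nearest pair and the origin has an occupied neighbour. This gives a nearer
pair, unless the one is at `-1` with `-2` empty, which is the case `pairDist ω = 0`. -/
theorem pairDist_eq_succ_iff {ω : NonIso} (k : ℕ) :
    pairDist ω = (k + 1 : ℕ) ↔ ω.1 (-((k + 1 : ℕ) : ℤ) - 1) = true ∧ ω.1 (-((k + 1 : ℕ) : ℤ)) = true ∧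
      ∀ i, -((k + 1 : ℕ) : ℤ) < i → i < 0 → ω.1 i = false := by
  constructor
  · intro h
    have hn : ¬ (ω.1 (-2) = false ∧ ω.1 (-1) = true) := by
      rw [← pairDist_eq_zero_iff, h]; simp
    have hlt : ∀ j : ℕ, 1 ≤ j → j < k + 1 →
        ¬ (ω.1 (-(j : ℤ) - 1) = true ∧ ω.1 (-(j : ℤ)) = true) := fun j hj hj' hc => by
      have := pairDist_le hj hc
      rw [h] at this
      exact absurd (Nat.cast_le.1 this) hj'.not_ge
    have hz : ∀ i, -((k + 1 : ℕ) : ℤ) < i → i < 0 → ω.1 i = false := by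
      intro i hi hi'
      by_contra hc
      rw [Bool.not_eq_false] at hc
      have hprev : ω.1 (i - 1) = false := by
        by_contra hc'
        rw [Bool.not_eq_false] at hc'
        obtain ⟨j, hj⟩ := Int.eq_ofNat_of_zero_le (show 0 ≤ -i by lia)
        refine hlt j (by lia) (by lia) ?_
        rw [← show i = -(j : ℤ) by lia]
        exact ⟨hc', hc⟩
      have hnext := (mem_range_T_iff.1 ω.2 i hc).resolve_left (by simp [hprev])
      rcases (show i = -1 ∨ i + 1 < 0 by lia) with rfl | hi2
      · exact hn ⟨hprev, hc⟩
      · obtain ⟨j, hj⟩ := Int.eq_ofNat_of_zero_le (show 0 ≤ -i - 1 by lia)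
        refine hlt j (by lia) (by lia) ?_
        rw [← show i + 1 = -(j : ℤ) by lia, add_sub_cancel_right]
        exact ⟨hc, hnext⟩
    have hpair : ω.1 (-((k + 1 : ℕ) : ℤ) - 1) = true ∧ ω.1 (-((k + 1 : ℕ) : ℤ)) = true := by
      by_contra hc
      rw [pairDist, if_neg hn] at h
      have : ((k + 2 : ℕ) : ℕ∞) ≤ (k + 1 : ℕ) := by
        rw [← h]
        refine le_iInf₂ fun i hi => Nat.cast_le.2 ?_
        by_contra! hlt'
        rcases (show i = k + 1 ∨ i < k + 1 by lia) with rfl | h'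
        · exact hc hi.2
        · exact hlt i hi.1 h' hi.2
      have := Nat.cast_le.1 this
      lia
    exact ⟨hpair.1, hpair.2, hz⟩
  · rintro ⟨h1, h2, h3⟩
    refine le_antisymm (pairDist_le (by lia) ⟨h1, h2⟩) ?_
    have hn : ¬ (ω.1 (-2) = false ∧ ω.1 (-1) = true) := by
      rintro ⟨h4, h5⟩
      cases k with
      | zero => norm_num at h1; simp [h1] at h4
      | succ k => rw [h3 (-1) (by push_cast; lia) (by lia)] at h5; simp at h5
    rw [pairDist, if_neg hn]
    refine le_iInf₂ fun i hi => Nat.cast_le.2 ?_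
    by_contra! hlt
    have := h3 (-i) (by lia) (by lia)
    rw [this] at hi
    simp at hi

end PairDistEq

theorem mem_iff_of_measurableSet {l : ℤ} {B : Set NonIso} (hB : MeasurableSet[sigmaAlg (Iio l)] B)
    {ω ω' : NonIso} (h : ∀ i < l, ω.1 i = ω'.1 i) : ω ∈ B ↔ ω' ∈ B := by
  rw [sigmaAlg_Iio_eq_comap] at hB
  obtain ⟨s, -, rfl⟩ := hB
  rw [mem_preimage, mem_preimage, extend_congr true h]

/-- The configuration which agrees with `η` up to `s` and vanishes after `s`. -/
def cut (s : ℤ) (η : Config) : Config := fun i => if i ≤ s then η i else false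

theorem measurable_cut (s : ℤ) : Measurable[cylinderEvents (Iic s)] (cut s) := by
  refine @measurable_pi_lambda _ _ _ (cylinderEvents (Iic s)) _ _ fun i => ?_
  by_cases hi : i ≤ s
  · simpa only [cut, if_pos hi] using
      measurable_cylinderEvent_apply (X := fun _ : ℤ => Bool) (Δ := Iic s) hi
  · simp only [cut, if_neg hi]
    exact measurable_const

/-- The event that `s - 1` and `s` are occupied and that the past of the thinned configuration
lies in `B`, provided that the thinned configuration vanishes after `s`. -/
def pastSet (s : ℤ) (B : Set NonIso) : Set Config :=
  {η | η (s - 1) = true} ∩ {η | η s = true} ∩ {η | rangeFactorization T (cut s η) ∈ B}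

theorem measurable_rangeFactorization_T : Measurable (rangeFactorization T) :=
  measurable_T.subtype_mk

theorem measurableSet_pastSet (s : ℤ) {B : Set NonIso} (hB : MeasurableSet B) :
    MeasurableSet[cylinderEvents (Iic s)] (pastSet s B) :=
  ((measurableSet_eval_eq_config (mem_Iic.2 (by lia)) _).inter
    (measurableSet_eval_eq_config (mem_Iic.2 le_rfl) _)).inter
      ((measurable_rangeFactorization_T.comp (measurable_cut s)) hB)

/-- Adjacent ones protect each other from removal. -/
theorem T_pair_iff (s : ℤ) (η : Config) :
    T η (s - 1) = true ∧ T η s = true ↔ η (s - 1) = true ∧ η s = true := by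
  simp only [T, sub_add_cancel]
  cases η (s - 1) <;> cases η s <;> simp

theorem pairDist_shift_T_iff (s : ℤ) (k : ℕ) (η : Config) :
    pairDist (shift (s + k + 1) (rangeFactorization T η)) = (k + 1 : ℕ) ↔
      (η (s - 1) = true ∧ η s = true) ∧ η ∈ gapSet s k := by
  rw [pairDist_eq_succ_iff, ← and_assoc]
  have e1 : -((k + 1 : ℕ) : ℤ) - 1 + (s + k + 1) = s - 1 := by push_cast; ring
  have e2 : -((k + 1 : ℕ) : ℤ) + (s + k + 1) = s := by push_cast; ring
  simp only [shift, rangeFactorization_coe, e1, e2, T_pair_iff]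
  refine and_congr_right fun h => ?_
  rw [mem_gapSet_iff k h.2]
  constructor
  · intro H i hi hi'
    have := H (i - (s + k + 1)) (by push_cast; lia) (by lia)
    rwa [sub_add_cancel] at this
  · intro H i hi hi'
    exact H _ (by push_cast at hi; lia) (by lia)

/-- Given the pair, `s` survives whatever follows it, so cutting `η` after `s` changes no thinned
spin up to `s`; at the next `k` sites both thinned configurations vanish. Thus `B` becomes an event
of the spins up to `s`, independent of the gap. -/
theorem mem_pastSet_iff {s : ℤ} {k : ℕ} {B : Set NonIso}
    (hB : MeasurableSet[sigmaAlg (Iio (s + k + 1))] B) {η : Config} (hη : η ∈ gapSet s k) :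
    η ∈ pastSet s B ↔ (η (s - 1) = true ∧ η s = true) ∧ rangeFactorization T η ∈ B := by
  refine and_congr_right fun h => ?_
  refine mem_iff_of_measurableSet hB fun i hi => ?_
  have h1 : η (s - 1) = true := h.1
  have h2 : η s = true := h.2
  simp only [rangeFactorization_coe]
  rcases lt_trichotomy i s with h3 | rfl | h3
  · simp [T, cut, show i ≤ s by lia, show i ≤ s + 1 by lia, show i + 1 ≤ s by lia]
  · simp [T, cut, h1, h2]
  · rw [(mem_gapSet_iff k h2).1 hη i h3 (by lia)]
    simp [T, cut, h3.not_ge]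

theorem mem_gapSet_succ_iff {s : ℤ} {k : ℕ} {η : Config} (hs : η s = true) :
    η ∈ gapSet s (k + 1) ↔ η ∈ gapSet s k ∧ T η (s + k + 1) = false := by
  rw [mem_gapSet_iff _ hs, mem_gapSet_iff _ hs]
  constructor
  · intro h
    exact ⟨fun i hi hi' => h i hi (by push_cast; lia), h _ (by lia) (by push_cast; lia)⟩
  · rintro ⟨h1, h2⟩ i hi hi'
    rcases (show i = s + k + 1 ∨ i ≤ s + k by push_cast at hi'; lia) with rfl | h
    · exact h2
    · exact h1 i hi h

/-! ### Conditional probabilities and consistency of the thinned field -/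

section Conditional

variable {p : I}

theorem measurable_pairDist_shift (l : ℤ) : Measurable fun ω => pairDist (shift l ω) :=
  measurable_pairDist.comp (measurable_shift l)

theorem tbf_apply {A : Set NonIso} (hA : MeasurableSet A) :
    tbf p A = bernoulliField p (rangeFactorization T ⁻¹' A) :=
  Measure.map_apply measurable_rangeFactorization_T hA

theorem measurableSet_zero (l : ℤ) : MeasurableSet {ω : NonIso | ω.1 l = false} :=
  sigmaAlg_le univ _ (measurableSet_eval_eq (mem_univ l) false)

variable (h0 : 0 < p) (h1 : p < 1)

include h0 h1 in
-- Without pairs in the thinned past, the Bernoulli field is pair-free on the `2 * n` sites before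
-- `l` for every `n`.
theorem tbf_pairDist_eq_top (l : ℤ) :
    tbf p {ω | pairDist (shift l ω) = ⊤} = 0 := by
  have hp0 : 0 < (p : ℝ) := h0
  have hp1 : (p : ℝ) < 1 := h1
  have hm : MeasurableSet {ω : NonIso | pairDist (shift l ω) = ⊤} :=
    measurable_pairDist_shift l (measurableSet_singleton ⊤)
  rw [tbf_apply hm]
  have hle : ∀ n : ℕ, bernoulliField p (rangeFactorization T ⁻¹' {ω | pairDist (shift l ω) = ⊤}) ≤
      ENNReal.ofReal ((1 - (p : ℝ) ^ 2) ^ n) := by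
    intro n
    refine le_trans (measure_mono ?_) ((bernoulliField_pairFreeSet h0 h1 (2 * n)
      (l - (2 * n : ℕ))).trans_le (ENNReal.ofReal_le_ofReal (pairFree_two_mul_le hp0 hp1 n)))
    intro η hη i hi hi' hc
    obtain ⟨j, hj⟩ := Int.eq_ofNat_of_zero_le (show 0 ≤ l - (i + 1) by lia)
    have e1 : -(j : ℤ) - 1 + l = i + 1 - 1 := by lia
    have e2 : -(j : ℤ) + l = i + 1 := by lia
    have hT := (T_pair_iff (i + 1) η).2 (by simpa using hc)
    have h := pairDist_le (ω := shift l (rangeFactorization T η)) (i := j) (by lia) (by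
      simpa only [shift, rangeFactorization_coe, e1, e2] using hT)
    have hη' : pairDist (shift l (rangeFactorization T η)) = ⊤ := hη
    rw [hη'] at h
    exact absurd h (by simp)
  have hlim : Filter.Tendsto (fun n : ℕ => ENNReal.ofReal ((1 - (p : ℝ) ^ 2) ^ n)) Filter.atTop
      (nhds 0) := by
    rw [← ENNReal.ofReal_zero]
    refine ENNReal.tendsto_ofReal (tendsto_pow_atTop_nhds_zero_of_lt_one ?_ ?_)
    · nlinarith
    · nlinarith [pow_pos hp0 2]
  exact le_antisymm (ge_of_tendsto' hlim hle) zero_le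

include h0 h1 in
theorem tbf_inter_zero_pairDist {l : ℤ} {B : Set NonIso} (hB : MeasurableSet[sigmaAlg (Iio l)] B)
    (n : ℕ∞) :
    tbf p ({ω | pairDist (shift l ω) = n} ∩ (B ∩ {ω | ω.1 l = false})) =
      ENNReal.ofReal (zeroProb p n) * tbf p ({ω | pairDist (shift l ω) = n} ∩ B) := by
  have hp0 : 0 < (p : ℝ) := h0
  have hp1 : (p : ℝ) < 1 := h1
  have hB' : MeasurableSet B := sigmaAlg_le _ B hB
  have hm : ∀ m, MeasurableSet {ω : NonIso | pairDist (shift l ω) = m} := fun m =>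
    measurable_pairDist_shift l (measurableSet_singleton m)
  induction n using ENat.recTopCoe with
  | top =>
    rw [measure_mono_null inter_subset_left (tbf_pairDist_eq_top h0 h1 l),
      measure_mono_null inter_subset_left (tbf_pairDist_eq_top h0 h1 l), mul_zero]
  | coe n =>
    cases n with
    | zero =>
      rw [Nat.cast_zero, zeroProb_zero, ENNReal.ofReal_zero, zero_mul]
      convert measure_empty (μ := tbf p)
      refine eq_empty_of_forall_notMem ?_
      rintro ω ⟨h2, -, h3⟩
      have h4 : pairDist (shift l ω) = 0 := h2
      rw [pairDist_eq_zero_iff] at h4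
      have h5 : ω.1 l = false := h3
      have h6 : ω.1 (l - 1 - 1) = false := by
        simpa [shift, show -2 + l = l - 1 - 1 by ring] using h4.1
      -- A one at `l - 1` with both neighbours empty would be isolated.
      have h7 : ω.1 (l - 1) = true := by
        simpa [shift, show -1 + l = l - 1 by ring] using h4.2
      simpa [h5, h6] using mem_range_T_iff.1 ω.2 (l - 1) h7
    | succ k =>
      -- `s` is the right end of the last pair before `l`, with `k` zeros between them.
      obtain ⟨s, rfl⟩ : ∃ s, l = s + k + 1 := ⟨l - k - 1, by ring⟩
      have hd : Disjoint (Iic s) (Ioi s) := Iic_disjoint_Ioi le_rfl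
      have e1 : rangeFactorization T ⁻¹'
          ({ω | pairDist (shift (s + k + 1) ω) = (k + 1 : ℕ)} ∩ B) =
            pastSet s B ∩ gapSet s k := by
        ext η
        have := pairDist_shift_T_iff s k η
        simp only [mem_preimage, mem_inter_iff, mem_ofPred_eq, this]
        constructor
        · rintro ⟨⟨h2, h3⟩, h4⟩
          exact ⟨(mem_pastSet_iff hB h3).2 ⟨h2, h4⟩, h3⟩
        · rintro ⟨h2, h3⟩
          have h4 := (mem_pastSet_iff hB h3).1 h2
          exact ⟨⟨h4.1, h3⟩, h4.2⟩
      have e2 : rangeFactorization T ⁻¹'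
          ({ω | pairDist (shift (s + k + 1) ω) = (k + 1 : ℕ)} ∩
            (B ∩ {ω | ω.1 (s + k + 1) = false})) = pastSet s B ∩ gapSet s (k + 1) := by
        rw [← inter_assoc, preimage_inter, e1, inter_assoc]
        ext η
        refine and_congr_right fun h => ?_
        exact (mem_gapSet_succ_iff h.1.2).symm
      rw [tbf_apply ((hm _).inter (hB'.inter (measurableSet_zero _))), tbf_apply ((hm _).inter hB'),
        e1, e2, bernoulliField_inter hd (measurableSet_pastSet s hB') (measurableSet_gapSet s _),
        bernoulliField_inter hd (measurableSet_pastSet s hB') (measurableSet_gapSet s _),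
        bernoulliField_gapSet h0 h1, bernoulliField_gapSet h0 h1, gapProb_succ h0 h1,
        ENNReal.ofReal_mul (zeroProb_nonneg hp0 hp1 _)]
      ring

include h0 h1 in
theorem tbf_inter_zero {l : ℤ} {B : Set NonIso} (hB : MeasurableSet[sigmaAlg (Iio l)] B) :
    tbf p (B ∩ {ω | ω.1 l = false}) = ∫⁻ ω in B, siteProb p l false ω ∂tbf p := by
  have hB' : MeasurableSet B := sigmaAlg_le _ B hB
  have hn := measurable_pairDist_shift l
  -- The distance takes countably many values, so the integral is a sum over its level sets.
  have hmap : ∀ {A : Set NonIso} (f : ℕ∞ → ℝ≥0∞), MeasurableSet A →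
      ∫⁻ ω in A, f (pairDist (shift l ω)) ∂tbf p =
        ∑' n, f n * tbf p ({ω | pairDist (shift l ω) = n} ∩ A) := by
    intro A f hA
    rw [← lintegral_map (measurable_of_countable f) hn, lintegral_countable']
    refine tsum_congr fun n => ?_
    rw [Measure.map_apply hn (measurableSet_singleton n),
      Measure.restrict_apply (hn (measurableSet_singleton n))]
    rfl
  have h1' := hmap (A := B ∩ {ω | ω.1 l = false}) (fun _ => 1) (hB'.inter (measurableSet_zero l))
  rw [setLIntegral_one] at h1'
  rw [h1']
  refine Eq.trans ?_ (hmap (fun n => ENNReal.ofReal (zeroProb p n)) hB').symm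
  refine tsum_congr fun n => ?_
  rw [one_mul, tbf_inter_zero_pairDist h0 h1 hB]

include h0 h1 in
theorem tbf_inter_eval {l : ℤ} (x : Bool) {B : Set NonIso}
    (hB : MeasurableSet[sigmaAlg (Iio l)] B) :
    tbf p (B ∩ {ω | ω.1 l = x}) = ∫⁻ ω in B, siteProb p l x ω ∂tbf p := by
  cases x
  · exact tbf_inter_zero h0 h1 hB
  · have hB' : MeasurableSet B := sigmaAlg_le _ B hB
    have h2 := measure_inter_add_sdiff (μ := tbf p) B (measurableSet_zero l)
    have h3 : ∫⁻ ω in B, siteProb p l false ω ∂tbf p + ∫⁻ ω in B, siteProb p l true ω ∂tbf p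
        = tbf p B := by
      rw [← lintegral_add_left (measurable_siteProb _ _ _)]
      simp only [siteProb_false_add_true (p := p) h0 h1]
      exact setLIntegral_one B
    rw [← h3, ← tbf_inter_zero h0 h1 hB] at h2
    rw [← (ENNReal.add_right_inj (measure_ne_top _ _)).1 h2]
    congr 1
    ext ω
    simp

include h0 h1 in
theorem setLIntegral_tbf_eval {l : ℤ} (x : Bool) {f : NonIso → ℝ≥0∞}
    (hf : Measurable[sigmaAlg (Iio l)] f) :
    ∫⁻ ω in {ω | ω.1 l = x}, f ω ∂tbf p = ∫⁻ ω, siteProb p l x ω * f ω ∂tbf p := by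
  have hle := sigmaAlg_le (Iio l)
  -- The identity for events of the past is an equality of two measures on the past, which then
  -- integrates every `f` measurable there.
  have key : ((tbf p).restrict {ω | ω.1 l = x}).trim hle =
      ((tbf p).withDensity (siteProb p l x)).trim hle := by
    refine @Measure.ext _ (sigmaAlg (Iio l)) _ _ fun B hB => ?_
    have hB' : MeasurableSet B := hle B hB
    rw [trim_measurableSet_eq _ hB, trim_measurableSet_eq _ hB, Measure.restrict_apply hB',
      withDensity_apply _ hB', tbf_inter_eval h0 h1 x hB]
  rw [← lintegral_trim hle hf, key, lintegral_trim hle hf,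
    lintegral_withDensity_eq_lintegral_mul _ (measurable_siteProb _ _ _)
      (hf.mono hle le_rfl)]
  rfl

/-- Extending by the actual spin never triggers the correction in `extend`: if the past ends in
`01`, then `ω` already has a one at `l`. -/
theorem apply_extend_eq {l : ℤ} {f : NonIso → ℝ≥0∞} (hf : Measurable[sigmaAlg (Iio (l + 1))] f)
    (ω : NonIso) : f (extend l (ω.1 l) ω) = f ω := by
  refine apply_eq_of_measurable hf fun i hi => ?_
  rcases (Int.lt_add_one_iff.1 hi).lt_or_eq with hi | rfl
  · exact extend_apply_of_lt _ _ hi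
  · cases h : ω.1 i
    · rw [extend_false_apply_of_le ω le_rfl]
      have h2 := mem_range_T_iff.1 ω.2 (i - 1)
      rw [sub_add_cancel, h, show i - 1 - 1 = i - 2 by ring] at h2
      cases h3 : ω.1 (i - 1)
      · simp
      · simpa using h2 h3
    · exact extend_true_apply_of_le ω le_rfl

include h0 h1 in
theorem lintegral_step {l : ℤ} {f : NonIso → ℝ≥0∞} (hf : Measurable[sigmaAlg (Iio (l + 1))] f) :
    ∫⁻ ω, step p l f ω ∂tbf p = ∫⁻ ω, f ω ∂tbf p := by
  have hf' : Measurable f := hf.mono (sigmaAlg_le _) le_rfl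
  have hc : ∀ x, Measurable[sigmaAlg (Iio l)] fun ω => f (extend l x ω) := fun x =>
    hf'.comp (measurable_extend l x)
  have hx : ∀ x, ∫⁻ ω, siteProb p l x ω * f (extend l x ω) ∂tbf p =
      ∫⁻ ω in {ω | ω.1 l = x}, f ω ∂tbf p := by
    intro x
    rw [← setLIntegral_tbf_eval h0 h1 x (hc x)]
    refine setLIntegral_congr_fun (sigmaAlg_le univ _ (measurableSet_eval_eq (mem_univ l) x)) ?_
    rintro ω rfl
    exact apply_extend_eq hf ω
  have hm : Measurable fun ω => siteProb p l false ω * f (extend l false ω) :=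
    (measurable_siteProb _ _ _).mul ((hc false).mono (sigmaAlg_le _) le_rfl)
  unfold step
  rw [lintegral_add_left hm, hx, hx,
    show {ω : NonIso | ω.1 l = true} = {ω : NonIso | ω.1 l = false}ᶜ by ext ω; simp]
  exact lintegral_add_compl f (measurableSet_zero l)

include h0 h1 in
theorem lintegral_avg {l : ℤ} (n : ℕ) {f : NonIso → ℝ≥0∞}
    (hf : Measurable[sigmaAlg (Iio (l + n))] f) :
    ∫⁻ ω, avg p l n f ω ∂tbf p = ∫⁻ ω, f ω ∂tbf p := by
  induction n generalizing f with
  | zero => rfl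
  | succ n ih =>
    have hf' : Measurable f := hf.mono (sigmaAlg_le _) le_rfl
    -- The last site is split off, although `avg` recurses on the first: one step at `l + n` yields
    -- a function of the past of `l + n`, as the induction hypothesis requires.
    rw [avg_add f l n 1]
    exact (ih (measurable_step hf')).trans (lintegral_step h0 h1 (by
      rwa [show l + n + 1 = l + (n + 1 : ℕ) by push_cast; ring]))

theorem isConsistent_lis : IsConsistent (tbf p) (lis p h0 h1) := by
  intro Λ f hf
  simp only [lintegral_lis_kernel Λ _ hf]
  rw [sigmaAlg_Iic, ← fst_add_size] at hf
  exact lintegral_avg h0 h1 _ hf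

end Conditional

end ThinnedBernoulli

open ThinnedBernoulli

theorem mainTheorem4 (p : I) (hp0 : 0 < p) (hp1 : p < 1) :
    spectrum ℝ (transferMatrix p) = {lamR p, lamPF p} ∧
    ∃ (ρ : LeftIntervalSpecification) (g : ℕ∞ → ℝ),
      ρ.IsTranslationInvariant ∧
      IsConsistent (tbf p) ρ ∧
      (∀ ω : NonIso, ρ.originProb false ω = g (pairDist ω)) ∧
      (∀ ω : NonIso,
        ρ.gFunction ω = if ω.1 0 = false then g (pairDist ω) else 1 - g (pairDist ω)) ∧
      g 0 = 0 ∧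
      g 1 = 1 - p ∧
      (∀ n : ℕ, 2 ≤ n →
        g n =
          ((-1) ^ (n + 1) * |eigRatio p| ^ n * (lamPF p / (1 - lamR p))
              + lamPF p / (1 - lamPF p)) /
            ((-1) ^ n * |eigRatio p| ^ (n - 1) * (1 / (1 - lamR p))
              + 1 / (1 - lamPF p))) ∧
      g ⊤ = (lamPF p / (1 - lamPF p)) / (1 / (1 - lamPF p)) := by
  have h0 : 0 < (p : ℝ) := hp0
  have h1 : (p : ℝ) < 1 := hp1
  refine ⟨spectrum_transferMatrix h0.le h1.le, lis p h0 h1, zeroProb p,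
    lis_isTranslationInvariant, isConsistent_lis h0 h1, originProb_lis_false, fun ω => ?_,
    zeroProb_zero _, zeroProb_one _, fun n hn => zeroProb_eq h0 h1 hn, ?_⟩
  · rw [LeftIntervalSpecification.gFunction]
    cases ω.1 0
    · exact originProb_lis_false ω
    · exact originProb_lis_true ω
  · have := sub_pos.2 (lamPF_lt_one h0 h1)
    rw [zeroProb_top]
    field_simp
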